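/- For $n\ge 1$ let $f(n)$ be the smallest integer $f$ such that every bounded set in $\mathbb R^n$ with at least two points can be partitioned into at most $f$ sets of smaller diameter. Let $M\subset\mathbb R^{24}$ be the set of unit-length elements of the Leech lattice $\Lambda_{24}$, in its standard coordinates scaled so that the shortest nonzero vectors have length $1$: the points $\frac{1}{4\sqrt2}z$ of $\Lambda_{24}$ come from those $z\in\mathbb Z^{24}$ for which there is an integer $m$ with $z_i\equiv m \pmod 2$ for all $i$, $\sum_i z_i\equiv 4m\pmod 8$, and, for each $k$, the set $\{i: z_i\equiv k \pmod 4\}$ is the support of a word of the extended binary Golay code (the cyclic code of length $23$ with generator polynomial $X^{11}+X^{10}+X^6+X^5+X^4+X^2+1$, extended by a parity bit). For an orthonormal basis $\big((e_i)_{i=1}^{24},(f_i)_{i=1}^{24},(g_{i,j})_{1\le i<j\le 24}\big)$ of $\mathbb R^{324}$ define $\Phi:\mathbb R^{24}\to\mathbb R^{324}$ by $$\Phi(x_1,\dots,x_{24})=\frac{2}{\sqrt5}\sum_{i=1}^{24}x_i^2e_i+\frac1{\sqrt5}\sum_{i=1}^{24}x_if_i+\frac{2\sqrt2}{\sqrt5}\sum_{1\le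 i<j\le 24}x_ix_j\,g_{i,j}.$$ Then there are a set $K\subset M$ with exactly $143136$ elements and indices $1\le k<l\le 24$ such that $|x_k|=|x_l|$ for all $x=(x_1,\dots,x_{24})\in K$. For every choice of the orthonormal basis, $\Phi(K)$ lies in a $322$-dimensional affine subspace of $\mathbb R^{324}$, and (Hinrichs) every subset of $\Phi(M)$ whose diameter is smaller than that of $\Phi(M)$ has at most $350$ elements. Consequently $$f(322)\ \ge\ \Big\lceil \frac{|K|}{350}\Big\rceil=\Big\lceil \frac{143136}{350}\Big\rceil=409 .$$ -/

import Mathlib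

noncomputable section

namespace Borsuk

/-- `A` is a disjoint union of at most `m` sets of diameter smaller than that of `A`.
Parts may be empty, which is how "at most" is expressed; a nonempty part occurs only once. -/
def PartitionsIntoSmaller {n : ℕ} (A : Set (EuclideanSpace ℝ (Fin n))) (m : ℕ) : Prop :=
  ∃ P : Fin m → Set (EuclideanSpace ℝ (Fin n)),
    (⋃ i, P i) = A ∧ Pairwise (fun i j => Disjoint (P i) (P j)) ∧
      ∀ i, Metric.diam (P i) < Metric.diam A

/-- The Borsuk number `f(n)`: the least `m` such that every bounded subset of `ℝⁿ` with at least
two points is a disjoint union of at most `m` sets of smaller diameter. -/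
def borsukNumber (n : ℕ) : ℕ :=
  sInf {m : ℕ | ∀ A : Set (EuclideanSpace ℝ (Fin n)),
    Bornology.IsBounded A → A.Nontrivial → PartitionsIntoSmaller A m}

/-- The `j`-th generator of the extended binary Golay code: the coefficients of
`X ^ j * (X ^ 11 + X ^ 10 + X ^ 6 + X ^ 5 + X ^ 4 + X ^ 2 + 1)` in positions `0, …, 22`, followed
by a parity bit in position `23`. -/
def golayGenerator (j : Fin 12) : Fin 24 → ZMod 2 := fun i =>
  if (i : ℕ) = 23 ∨
      ∃ e ∈ ({0, 2, 4, 5, 6, 10, 11} : Finset ℕ), (i : ℕ) = (j : ℕ) + e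
  then 1 else 0

/-- The extended binary Golay code, a `[24, 12, 8]` linear code. -/
def golayCode : Submodule (ZMod 2) (Fin 24 → ZMod 2) :=
  Submodule.span (ZMod 2) (Set.range golayGenerator)

/-- The integer vectors `z` for which `z / √8` belongs to the Leech lattice in its usual
(unimodular) scale: all coordinates are congruent to some `m` modulo `2`, their sum is congruent
to `4 * m` modulo `8`, and for every `k` the coordinates congruent to `k` modulo `4` occupy the
support of a Golay codeword. -/
def IsLeechVector (z : Fin 24 → ℤ) : Prop :=
  ∃ m : ℤ, (∀ i, z i ≡ m [ZMOD 2]) ∧ (∑ i, z i) ≡ 4 * m [ZMOD 8] ∧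
    ∀ k : ℤ, (fun i => if z i ≡ k [ZMOD 4] then (1 : ZMod 2) else 0) ∈ golayCode

/-- The Leech lattice, scaled so that its shortest nonzero vectors have length `1`. -/
def leechLattice : Set (EuclideanSpace ℝ (Fin 24)) :=
  {x | ∃ z : Fin 24 → ℤ, IsLeechVector z ∧ ∀ i, x i = (z i : ℝ) / (4 * √2)}

/-- The elements of unit length in the (rescaled) Leech lattice. -/
def M : Set (EuclideanSpace ℝ (Fin 24)) := {x | x ∈ leechLattice ∧ ‖x‖ = 1}

/-- Index set of the basis vectors `e i`, `f i` and `g i j` with `i < j`, in this order. -/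
abbrev BasisIndex : Type := Fin 24 ⊕ Fin 24 ⊕ {p : Fin 24 × Fin 24 // p.1 < p.2}

/-- The map `Φ : ℝ²⁴ → ℝ³²⁴` belonging to an orthonormal basis of `ℝ³²⁴`. -/
def Phi (b : OrthonormalBasis BasisIndex ℝ (EuclideanSpace ℝ (Fin 324)))
    (x : EuclideanSpace ℝ (Fin 24)) : EuclideanSpace ℝ (Fin 324) :=
  (2 / √5) • (∑ i, (x i) ^ 2 • b (Sum.inl i)) +
  (1 / √5) • (∑ i, x i • b (Sum.inr (Sum.inl i))) +
  (2 * √2 / √5) • (∑ p : {p : Fin 24 × Fin 24 // p.1 < p.2},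
    (x p.1.1 * x p.1.2) • b (Sum.inr (Sum.inr p)))

/-- Orthonormal bases of `ℝ³²⁴` with this index set exist. -/
theorem nonempty_orthonormalBasis :
    Nonempty (OrthonormalBasis BasisIndex ℝ (EuclideanSpace ℝ (Fin 324))) := by
  have h : Fintype.card (Fin 324) = Fintype.card BasisIndex := by
    have h2 : Fintype.card {p : Fin 24 × Fin 24 // p.1 < p.2} = 276 := by
      rw [Fintype.card_subtype]; decide +kernel
    simp [h2]
  exact ⟨(EuclideanSpace.basisFun (Fin 324) ℝ).reindex (Fintype.equivOfCardEq h)⟩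

end Borsuk

end

namespace Borsuk

/-! For unit vectors, `⟪Φ x, Φ y⟫ = (4t² + t)/5` with `t = ⟪x, y⟫`. Inner products on `M` lie in
`{±1, ±1/2, ±1/4, 0}`, where `4t² + t ≥ 0` with equality exactly at `t = 0` and `t = -1/4`. So
distances in `Φ(M)` are at most `√2`, and a subset of smaller diameter comes from points of `M` with
mutual inner products in `{-1, -1/2, 1/4, 1/2}`.

Such a set is bounded by rank arguments modulo 2. A part without antipodal pairs has at most 324
points (`card_le_of_inner_mem`), and the antipodes left over number at most 25
(`card_le_of_inner_eq_half`).

The equations `∑ xᵢ² = 1` and `x₀² = x₁²` are linear in the coordinates of `Φ x`, so vectors with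
`|x₀| = |x₁|` have images in an affine subspace of dimension 322. Counting minimal Leech vectors of
this kind by shape gives 928 + 52096 + 90112 = 143136. Each part of smaller diameter holds at most
350 of them, so at least 409 parts are needed. -/

/-! ### The extended Golay code as a list of bit masks. -/

/-- The `j`-th generator of the Golay code, as a bit mask. -/
def golayMask (j : ℕ) : ℕ := (3189 <<< j) + 2 ^ 23

/-- The bit masks of the words spanned by the last `n` of the twelve generators. -/
def golayWords : ℕ → List ℕ
  | 0 => [0]
  | n + 1 => golayWords n ++ (golayWords n).map (fun w => w ^^^ golayMask (11 - n))

/-- The `i`-th bit of `w`, as an integer. -/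
def bit (w : ℕ) (i : Fin 24) : ℤ := if w.testBit i then 1 else 0

/-- The number of bits set among the first `n` ones, in a form that the kernel evaluates quickly. -/
noncomputable def lowWeight (n w : ℕ) : ℕ :=
  Nat.rec (fun _ => 0) (fun _ f w => Nat.add (Nat.mod w 2) (f (Nat.div w 2))) n w

/-- The number of bits set among the first `24` ones. -/
noncomputable def weight (w : ℕ) : ℕ := lowWeight 24 w

theorem lowWeight_succ (n w : ℕ) : lowWeight (n + 1) w = w % 2 + lowWeight n (w / 2) := rfl

theorem lowWeight_eq_sum (n w : ℕ) :
    lowWeight n w = ∑ i ∈ Finset.range n, if w.testBit i then 1 else 0 := by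
  induction n generalizing w with
  | zero => rfl
  | succ n ih =>
    rw [lowWeight_succ, ih, Finset.sum_range_succ', add_comm]
    simp only [Nat.testBit_succ, Nat.testBit_zero, decide_eq_true_eq]
    have := Nat.mod_two_eq_zero_or_one w
    split <;> omega

theorem weight_golayWords :
    ∀ w ∈ golayWords 12, weight w = 0 ∨ weight w = 8 ∨ weight w = 12 ∨ weight w = 16 ∨
      weight w = 24 := by
  -- The set of admissible weights is itself a bit mask, so each of the 4096 words costs one
  -- `testBit`.
  have h : (golayWords 12).all (fun w =>
      (2 ^ 0 + 2 ^ 8 + 2 ^ 12 + 2 ^ 16 + 2 ^ 24).testBit (weight w)) = true := by decide +kernel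
  have h' : ∀ k < 25, (2 ^ 0 + 2 ^ 8 + 2 ^ 12 + 2 ^ 16 + 2 ^ 24).testBit k = true →
      k = 0 ∨ k = 8 ∨ k = 12 ∨ k = 16 ∨ k = 24 := by decide
  intro w hw
  have hle : weight w < 25 := by
    rw [weight, lowWeight_eq_sum, Finset.sum_boole, Nat.cast_id, Nat.lt_succ_iff]
    exact (Finset.card_filter_le _ _).trans_eq (Finset.card_range 24)
  exact h' _ hle (List.all_eq_true.1 h w hw)

/-- The octads that contain both or neither of the first two positions. -/
noncomputable def octads : List ℕ :=
  (golayWords 12).filter (fun w => weight w == 8 && w.testBit 0 == w.testBit 1)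

/-- Of the 759 octads, 77 contain both positions and 330 contain neither. -/
theorem length_octads : octads.length = 407 := by decide +kernel

theorem length_golayWords (n : ℕ) : (golayWords n).length = 2 ^ n := by
  induction n with
  | zero => rfl
  | succ n ih => simp [golayWords, ih]; ring

theorem full_mem_golayWords : 2 ^ 24 - 1 ∈ golayWords 12 := by
  have h : (golayWords 12).contains (2 ^ 24 - 1) = true := by decide +kernel
  simpa using h

theorem zero_mem_golayWords (n : ℕ) : 0 ∈ golayWords n := by
  induction n with
  | zero => simp [golayWords]
  | succ n ih => simp [golayWords, ih]

theorem golayMask_mem_golayWords : ∀ j : Fin 12, golayMask j ∈ golayWords 12 := by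
  have h : (List.range 12).all (fun j => (golayWords 12).contains (golayMask j)) = true := by
    decide +kernel
  intro j
  simpa using List.all_eq_true.1 h j (by simp)

theorem xor_mem_golayWords (n : ℕ) {v w : ℕ} (hv : v ∈ golayWords n) (hw : w ∈ golayWords n) :
    v ^^^ w ∈ golayWords n := by
  induction n generalizing v w with
  | zero => simp_all [golayWords]
  | succ n ih =>
    simp only [golayWords, List.mem_append, List.mem_map] at hv hw ⊢
    rcases hv with hv | ⟨v, hv, rfl⟩ <;> rcases hw with hw | ⟨w, hw, rfl⟩
    · exact Or.inl (ih hv hw)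
    · exact Or.inr ⟨_, ih hv hw, Nat.xor_assoc _ _ _⟩
    · exact Or.inr ⟨_, ih hv hw, by rw [Nat.xor_right_comm]⟩
    · refine Or.inl ?_
      rw [Nat.xor_right_comm v, Nat.xor_assoc v, Nat.xor_assoc w,
        Nat.xor_self, Nat.xor_zero]
      exact ih hv hw

theorem mem_octads {w : ℕ} : w ∈ octads ↔
    w ∈ golayWords 12 ∧ weight w = 8 ∧ w.testBit 0 = w.testBit 1 := by
  simp [octads]

/-- The generators are in echelon form, which makes the 4096 words of the list distinct. -/
theorem golayMask_testBit : ∀ j < 12, (golayMask j).testBit j = true ∧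
    ∀ i < j, (golayMask j).testBit i = false := by
  decide +kernel

theorem golayWords_low_bits (n : ℕ) (hn : n ≤ 12) :
    ∀ w ∈ golayWords n, ∀ i < 12 - n, w.testBit i = false := by
  induction n with
  | zero => simp [golayWords]
  | succ n ih =>
    intro w hw i hi
    simp only [golayWords, List.mem_append, List.mem_map] at hw
    rcases hw with hw | ⟨v, hv, rfl⟩
    · exact ih (by omega) w hw i (by omega)
    · rw [Nat.testBit_xor, ih (by omega) v hv i (by omega),
        (golayMask_testBit (11 - n) (by omega)).2 i (by omega)]
      rfl

theorem nodup_golayWords (n : ℕ) (hn : n ≤ 12) : (golayWords n).Nodup := by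
  induction n with
  | zero => simp [golayWords]
  | succ n ih =>
    rw [golayWords, List.nodup_append]
    refine ⟨ih (by omega), (ih (by omega)).map (Nat.xor_left_injective), ?_⟩
    intro a ha b hb hab
    obtain ⟨v, hv, rfl⟩ := List.mem_map.1 hb
    have h1 := golayWords_low_bits n (by omega) a ha (11 - n) (by omega)
    have h2 := golayWords_low_bits n (by omega) v hv (11 - n) (by omega)
    rw [hab, Nat.testBit_xor, h2, (golayMask_testBit (11 - n) (by omega)).1] at h1
    simp at h1

theorem nodup_octads : octads.Nodup :=
  (nodup_golayWords 12 le_rfl).filter _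

theorem golayWords_lt : ∀ w ∈ golayWords 12, w < 2 ^ 24 := by
  have h : (golayWords 12).all (fun w => decide (w < 2 ^ 24)) = true := by decide +kernel
  intro w hw
  simpa using List.all_eq_true.1 h w hw

theorem bit_eq_zero_or_one (w : ℕ) (i : Fin 24) : bit w i = 0 ∨ bit w i = 1 := by
  unfold bit; split <;> simp

theorem bit_injOn {v w : ℕ} (hv : v < 2 ^ 24) (hw : w < 2 ^ 24) (h : bit v = bit w) : v = w := by
  refine Nat.eq_of_testBit_eq fun i => ?_
  by_cases hi : i < 24
  · have := congrFun h ⟨i, hi⟩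
    simp only [bit] at this
    by_cases h1 : v.testBit i <;> by_cases h2 : w.testBit i <;> simp_all
  · rw [Nat.testBit_lt_two_pow (hv.trans_le (Nat.pow_le_pow_right (by norm_num) (by omega))),
      Nat.testBit_lt_two_pow (hw.trans_le (Nat.pow_le_pow_right (by norm_num) (by omega)))]

theorem bit_xor (v w : ℕ) (i : Fin 24) :
    bit (v ^^^ w) i = bit v i + bit w i - 2 * (bit v i * bit w i) := by
  simp only [bit, Nat.testBit_xor]
  by_cases h1 : v.testBit i <;> by_cases h2 : w.testBit i <;> simp [h1, h2]

theorem bit_zero (i : Fin 24) : bit 0 i = 0 := by simp [bit]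

theorem bit_full (i : Fin 24) : bit (2 ^ 24 - 1) i = 1 := by
  simp only [bit, Nat.testBit_two_pow_sub_one]; simp

theorem sum_bit (w : ℕ) : ∑ i, bit w i = weight w := by
  rw [weight, lowWeight_eq_sum, ← Fin.sum_univ_eq_sum_range (fun i => if w.testBit i then 1 else 0)]
  push_cast
  rfl

/-- The bits of 3189 are the exponents 0, 2, 4, 5, 6, 10, 11 of the generator polynomial. There are
seven, so every shift has parity bit 1. -/
theorem golayGenerator_eq (j : Fin 12) :
    golayGenerator j = fun i => ((bit (golayMask j) i : ℤ) : ZMod 2) := by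
  funext i
  have h : ∀ j : Fin 12, ∀ i : Fin 24, ((i : ℕ) = 23 ∨
      ∃ e ∈ ({0, 2, 4, 5, 6, 10, 11} : Finset ℕ), (i : ℕ) = (j : ℕ) + e) ↔
      (golayMask j).testBit i = true := by decide +kernel
  simp only [golayGenerator, bit, h j i]
  split <;> simp

theorem cast_bit_xor (v w : ℕ) :
    (fun i => ((bit (v ^^^ w) i : ℤ) : ZMod 2)) =
      (fun i => ((bit v i : ℤ) : ZMod 2)) + fun i => ((bit w i : ℤ) : ZMod 2) := by
  funext i
  rw [bit_xor]
  push_cast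
  rw [show (2 : ZMod 2) = 0 from rfl]
  simp

theorem cast_bit_mem_golayCode_of_mem (n : ℕ) (hn : n ≤ 12) :
    ∀ w ∈ golayWords n, (fun i => ((bit w i : ℤ) : ZMod 2)) ∈ golayCode := by
  induction n with
  | zero =>
    intro w hw
    simp only [golayWords, List.mem_singleton] at hw
    subst hw
    simp only [bit_zero, Int.cast_zero]
    exact golayCode.zero_mem
  | succ n ih =>
    intro w hw
    simp only [golayWords, List.mem_append, List.mem_map] at hw
    rcases hw with hw | ⟨v, hv, rfl⟩
    · exact ih (by omega) w hw
    · rw [cast_bit_xor]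
      refine golayCode.add_mem (ih (by omega) v hv) ?_
      have := golayGenerator_eq ⟨11 - n, by omega⟩
      rw [← this]
      exact Submodule.subset_span ⟨_, rfl⟩

theorem exists_golayWord_of_mem_golayCode {c : Fin 24 → ZMod 2} (hc : c ∈ golayCode) :
    ∃ w ∈ golayWords 12, c = fun i => ((bit w i : ℤ) : ZMod 2) := by
  induction hc using Submodule.span_induction with
  | mem x h =>
    obtain ⟨j, rfl⟩ := h
    exact ⟨_, golayMask_mem_golayWords j, golayGenerator_eq j⟩
  | zero => exact ⟨0, zero_mem_golayWords 12, by funext i; simp [bit_zero]⟩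
  | add x y _ _ hx hy =>
    obtain ⟨v, hv, rfl⟩ := hx
    obtain ⟨w, hw, rfl⟩ := hy
    exact ⟨_, xor_mem_golayWords 12 hv hw, (cast_bit_xor v w).symm⟩
  | smul a x _ hx =>
    obtain ⟨v, hv, rfl⟩ := hx
    rcases (show ∀ a : ZMod 2, a = 0 ∨ a = 1 by decide) a with rfl | rfl
    · exact ⟨0, zero_mem_golayWords 12, by funext i; simp [bit_zero]⟩
    · exact ⟨v, hv, by rw [one_smul]⟩

attribute [irreducible] golayWords octads

/-! ### Norms and inner products of Leech vectors. -/

/-- `z` is a Leech vector with class `m`, codeword `w` and quotient `y`. -/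
def LeechForm (z : Fin 24 → ℤ) (m : ℤ) (w : ℕ) (y : Fin 24 → ℤ) : Prop :=
  w ∈ golayWords 12 ∧ (∀ i, z i = m + 2 * bit w i + 4 * y i) ∧ ∑ i, z i ≡ 4 * m [ZMOD 8]

theorem IsLeechVector.exists_form {z : Fin 24 → ℤ} (hz : IsLeechVector z) :
    ∃ m w y, LeechForm z m w y := by
  obtain ⟨m, h1, h2, h3⟩ := hz
  obtain ⟨w, hw, hwz⟩ := exists_golayWord_of_mem_golayCode (h3 (m + 2))
  refine ⟨m, w, fun i => (z i - m - 2 * bit w i) / 4, hw, fun i => ?_, h2⟩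
  have h4 := congrFun hwz i
  have h5 := h1 i
  have h6 : z i ≡ m + 2 [ZMOD 4] ↔ bit w i = 1 := by
    rcases bit_eq_zero_or_one w i with hb | hb <;> by_cases hk : z i ≡ m + 2 [ZMOD 4] <;>
      simp [hb, hk] at h4 ⊢
  simp only [Int.ModEq] at h5 h6
  have := bit_eq_zero_or_one w i
  dsimp only
  omega

theorem LeechForm.isLeechVector {z : Fin 24 → ℤ} {m : ℤ} {w : ℕ} {y : Fin 24 → ℤ}
    (h : LeechForm z m w y) : IsLeechVector z := by
  obtain ⟨hw, hz, hs⟩ := h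
  refine ⟨m, fun i => ?_, hs, fun k => ?_⟩
  · have := hz i
    simp only [Int.ModEq]
    omega
  have hc := cast_bit_mem_golayCode_of_mem 12 le_rfl
  have key : ∀ v ∈ golayWords 12, (∀ i, z i ≡ k [ZMOD 4] ↔ bit v i = 1) →
      (fun i => if z i ≡ k [ZMOD 4] then (1 : ZMod 2) else 0) ∈ golayCode := by
    intro v hv hvk
    convert hc v hv using 2 with i
    rcases bit_eq_zero_or_one v i with h | h <;> simp [hvk, h]
  have hb := bit_eq_zero_or_one w
  -- The positions congruent to `k` form the complement of `w`, the word `w`, or the empty word,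
  -- respectively.
  have : (k - m) % 4 = 0 ∨ (k - m) % 4 = 2 ∨ (k - m) % 2 = 1 := by omega
  rcases this with h | h | h
  · refine key _ (xor_mem_golayWords 12 full_mem_golayWords hw) fun i => ?_
    rw [bit_xor, bit_full]
    have := hz i
    simp only [Int.ModEq]
    rcases hb i with h | h <;> rw [h] at this ⊢ <;> omega
  · refine key _ hw fun i => ?_
    have := hz i
    simp only [Int.ModEq]
    rcases hb i with h | h <;> rw [h] at this ⊢ <;> omega
  · refine key _ (zero_mem_golayWords 12) fun i => ?_
    rw [bit_zero]
    have := hz i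
    simp only [Int.ModEq]
    omega

/-- Adding bits gives their xor plus a carry of 2 where both are set; after doubling, the carry goes
into the quotient. -/
theorem LeechForm.add {z z' : Fin 24 → ℤ} {m m' : ℤ} {w w' : ℕ} {y y' : Fin 24 → ℤ}
    (h : LeechForm z m w y) (h' : LeechForm z' m' w' y') :
    LeechForm (z + z') (m + m') (w ^^^ w') (fun i => y i + y' i + bit w i * bit w' i) := by
  refine ⟨xor_mem_golayWords 12 h.1 h'.1, fun i => ?_, ?_⟩
  · rw [Pi.add_apply, h.2.1, h'.2.1, bit_xor]
    ring
  · simp only [Pi.add_apply, Finset.sum_add_distrib, mul_add]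
    exact h.2.2.add h'.2.2

theorem LeechForm.neg {z : Fin 24 → ℤ} {m : ℤ} {w : ℕ} {y : Fin 24 → ℤ} (h : LeechForm z m w y) :
    LeechForm (-z) (-m) w (fun i => -y i - bit w i) := by
  refine ⟨h.1, fun i => ?_, ?_⟩
  · rw [Pi.neg_apply, h.2.1]
    ring
  · simp only [Pi.neg_apply, Finset.sum_neg_distrib, mul_neg]
    exact h.2.2.neg

theorem four_dvd_weight {w : ℕ} (hw : w ∈ golayWords 12) : (4 : ℤ) ∣ weight w := by
  rcases weight_golayWords w hw with h | h | h | h | h <;> rw [h] <;> norm_num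

/-- Expanding the square modulo 16 leaves `24m² + (4m + 4)·wt(w) + 8m·∑ y`. The weight is a multiple
of 4, and the condition modulo 8 on the sum of `z` forces `∑ y ≡ m` modulo 2. -/
theorem LeechForm.sixteen_dvd {z : Fin 24 → ℤ} {m : ℤ} {w : ℕ} {y : Fin 24 → ℤ}
    (h : LeechForm z m w y) : 16 ∣ z ⬝ᵥ z := by
  obtain ⟨hw, hz, hs⟩ := h
  obtain ⟨a, ha⟩ := four_dvd_weight hw
  have hsum : ∑ i, z i = 24 * m + 2 * (4 * a) + 4 * ∑ i, y i := by
    rw [← ha, ← sum_bit, Finset.mul_sum, Finset.mul_sum, Finset.sum_congr rfl fun i _ => hz i,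
      Finset.sum_add_distrib, Finset.sum_add_distrib]
    simp
  have hsq : z ⬝ᵥ z = 24 * m ^ 2 + (4 * m + 4) * (4 * a) + 8 * m * ∑ i, y i +
      16 * ∑ i, (bit w i * y i + y i ^ 2) := by
    rw [← ha, ← sum_bit, Finset.mul_sum, Finset.mul_sum, Finset.mul_sum]
    have : ∀ i, z i * z i = m ^ 2 + (4 * m + 4) * bit w i + 8 * m * y i +
        16 * (bit w i * y i + y i ^ 2) := by
      intro i
      rw [hz i]
      rcases bit_eq_zero_or_one w i with h | h <;> rw [h] <;> ring
    rw [dotProduct, Finset.sum_congr rfl fun i _ => this i,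
      Finset.sum_add_distrib, Finset.sum_add_distrib, Finset.sum_add_distrib]
    simp
  have hpar : ∃ b, ∑ i, y i = m + 2 * b := by
    rw [hsum] at hs
    exact ⟨(∑ i, y i - m) / 2, by simp only [Int.ModEq] at hs; omega⟩
  obtain ⟨b, hb⟩ := hpar
  rw [hsq, hb]
  exact ⟨2 * m ^ 2 + (m + 1) * a + m * b + ∑ i, (bit w i * y i + y i ^ 2), by ring⟩

/-- If `m` is odd, all coordinates are odd and the norm is at least 24. If `m` is even, `z/2` has
norm 4 and reduces modulo 2 to a codeword of weight at most 4, hence to zero. Then `z = 4v` with `v`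
of norm 1, whose odd coordinate sum violates the condition modulo 8. -/
theorem LeechForm.dotProduct_self_ne {z : Fin 24 → ℤ} {m : ℤ} {w : ℕ} {y : Fin 24 → ℤ}
    (h : LeechForm z m w y) : z ⬝ᵥ z ≠ 16 := by
  obtain ⟨hw, hz, hs⟩ := h
  intro h16
  rcases Int.even_or_odd' m with ⟨m, rfl | rfl⟩
  · set u : Fin 24 → ℤ := fun i => m + bit w i + 2 * y i with hu
    have hzu : ∀ i, z i = 2 * u i := fun i => by rw [hz i]; ring
    have hu4 : ∑ i, u i ^ 2 = 4 := by
      have : z ⬝ᵥ z = 4 * ∑ i, u i ^ 2 := by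
        rw [dotProduct, Finset.mul_sum]
        exact Finset.sum_congr rfl fun i _ => by rw [hzu]; ring
      omega
    have hev : ∀ i, 2 ∣ u i := by
      suffices ∃ v ∈ golayWords 12, ∀ i, bit v i ≡ u i [ZMOD 2] by
        obtain ⟨v, hv, hvu⟩ := this
        have hle : (weight v : ℤ) ≤ 4 := by
          rw [← sum_bit, ← hu4]
          refine Finset.sum_le_sum fun i _ => ?_
          rcases bit_eq_zero_or_one v i with h | h
          · rw [h]; positivity
          · have : u i ≠ 0 := by
              intro h0
              have := hvu i
              rw [h, h0] at this
              simp [Int.ModEq] at this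
            have := Int.one_le_abs this
            rw [h, ← sq_abs]
            nlinarith
        have h0 : weight v = 0 := by
          rcases weight_golayWords v hv with h | h | h | h | h <;> omega
        have hb0 : ∀ i, bit v i = 0 := by
          have h1 := sum_bit v
          rw [h0, Nat.cast_zero, Finset.sum_eq_zero_iff_of_nonneg] at h1
          · exact fun i => h1 i (Finset.mem_univ i)
          · intro i _
            rcases bit_eq_zero_or_one v i with h | h <;> omega
        intro i
        have := hvu i
        rw [hb0, Int.ModEq] at this
        omega
      -- Here `m` is half the original class; its parity decides between `w` and the complement.
      rcases Int.even_or_odd' m with ⟨k, rfl | rfl⟩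
      · exact ⟨w, hw, fun i => by simp only [hu, Int.ModEq]; omega⟩
      · refine ⟨_, xor_mem_golayWords 12 full_mem_golayWords hw, fun i => ?_⟩
        rw [bit_xor, bit_full]
        simp only [hu, Int.ModEq]
        omega
    choose v hv using hev
    have hv1 : ∑ i, v i ^ 2 = 1 := by
      have : ∑ i, u i ^ 2 = 4 * ∑ i, v i ^ 2 := by
        rw [Finset.mul_sum]
        exact Finset.sum_congr rfl fun i _ => by rw [hv]; ring
      omega
    have hpar : ∑ i, v i ^ 2 ≡ ∑ i, v i [ZMOD 2] := by
      rw [Int.modEq_iff_dvd, ← Finset.sum_sub_distrib]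
      refine Finset.dvd_sum fun i _ => ?_
      rcases Int.even_or_odd' (v i) with ⟨k, h | h⟩ <;> rw [h]
      · exact ⟨k - 2 * k ^ 2, by ring⟩
      · exact ⟨-k - 2 * k ^ 2, by ring⟩
    have hs4 : ∑ i, z i = 4 * ∑ i, v i := by
      rw [Finset.mul_sum]
      exact Finset.sum_congr rfl fun i _ => by rw [hzu, hv]; ring
    rw [hv1] at hpar
    rw [hs4] at hs
    simp only [Int.ModEq] at hpar hs
    omega
  · have : (24 : ℤ) ≤ z ⬝ᵥ z := by
      have : (24 : ℤ) = ∑ _i : Fin 24, 1 := by simp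
      rw [this]
      refine Finset.sum_le_sum fun i _ => ?_
      have h0 : z i ≠ 0 := by have := hz i; omega
      have := Int.one_le_abs h0
      rw [← abs_mul_abs_self]
      nlinarith
    omega

/-- Inner products of minimal Leech vectors. -/
theorem IsLeechVector.dotProduct_mem {z z' : Fin 24 → ℤ} (hz : IsLeechVector z)
    (hz' : IsLeechVector z') (h : z ⬝ᵥ z = 32) (h' : z' ⬝ᵥ z' = 32) :
    z ⬝ᵥ z' ∈ ({-32, -16, -8, 0, 8, 16, 32} : Finset ℤ) := by
  obtain ⟨m, w, y, hf⟩ := hz.exists_form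
  obtain ⟨m', w', y', hf'⟩ := hz'.exists_form
  -- Both `z ± z'` are Leech vectors. With `t = z ⬝ᵥ z'`, divisibility gives `8 ∣ t`, nonnegativity
  -- gives `|t| ≤ 32`, and the absence of norm 16 excludes `t = ±24`.
  have hadd : (z + z') ⬝ᵥ (z + z') = 64 + 2 * (z ⬝ᵥ z') := by
    simp only [add_dotProduct, dotProduct_add, h, h', dotProduct_comm z' z]
    ring
  have hsub : (z + -z') ⬝ᵥ (z + -z') = 64 - 2 * (z ⬝ᵥ z') := by
    simp only [add_dotProduct, dotProduct_add, dotProduct_neg, neg_dotProduct, h, h',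
      dotProduct_comm z' z]
    ring
  have hd := (hf.add hf').sixteen_dvd
  have hn := (hf.add hf').dotProduct_self_ne
  have hn' := (hf.add hf'.neg).dotProduct_self_ne
  have hp : 0 ≤ (z + z') ⬝ᵥ (z + z') := Finset.sum_nonneg fun i _ => mul_self_nonneg _
  have hp' : 0 ≤ (z + -z') ⬝ᵥ (z + -z') := Finset.sum_nonneg fun i _ => mul_self_nonneg _
  rw [hadd] at hd hn hp
  rw [hsub] at hn' hp'
  simp only [Finset.mem_insert, Finset.mem_singleton]
  omega

/-- The point of the rescaled lattice that belongs to an integer vector. -/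
noncomputable def leechPoint (z : Fin 24 → ℤ) : EuclideanSpace ℝ (Fin 24) :=
  WithLp.toLp 2 fun i => (z i : ℝ) / (4 * √2)

theorem inner_leechPoint (z z' : Fin 24 → ℤ) :
    inner ℝ (leechPoint z) (leechPoint z') = ((z ⬝ᵥ z' : ℤ) : ℝ) / 32 := by
  simp only [leechPoint, PiLp.inner_apply, dotProduct, Int.cast_sum, Finset.sum_div, Int.cast_mul]
  refine Finset.sum_congr rfl fun i _ => ?_
  have h2 : √(2 : ℝ) ^ 2 = 2 := Real.sq_sqrt (by norm_num)
  have h0 : √(2 : ℝ) ≠ 0 := by positivity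
  simp only [RCLike.inner_apply, conj_trivial]
  field_simp
  rw [h2]
  ring

theorem leechPoint_injective : Function.Injective leechPoint := by
  intro z z' h
  funext i
  have h1 : (z i : ℝ) / (4 * √2) = (z' i : ℝ) / (4 * √2) := congrArg (fun x => x.ofLp i) h
  have h0 : (4 * √(2 : ℝ)) ≠ 0 := by positivity
  exact_mod_cast (div_left_inj' h0).1 h1

theorem leechPoint_mem_M {z : Fin 24 → ℤ} (hz : IsLeechVector z) (h : z ⬝ᵥ z = 32) :
    leechPoint z ∈ M := by
  refine ⟨⟨z, hz, fun i => rfl⟩, ?_⟩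
  have := inner_leechPoint z z
  rw [h, real_inner_self_eq_norm_sq] at this
  have h1 : ‖leechPoint z‖ ^ 2 = 1 := by rw [this]; norm_num
  exact (pow_eq_one_iff_of_nonneg (norm_nonneg _) two_ne_zero).1 h1

theorem exists_eq_leechPoint {x : EuclideanSpace ℝ (Fin 24)} (hx : x ∈ M) :
    ∃ z, IsLeechVector z ∧ z ⬝ᵥ z = 32 ∧ x = leechPoint z := by
  obtain ⟨⟨z, hz, hxz⟩, h1⟩ := hx
  have hx : x = leechPoint z := by
    ext i
    exact hxz i
  refine ⟨z, hz, ?_, hx⟩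
  have := inner_leechPoint z z
  rw [← hx, real_inner_self_eq_norm_sq, h1] at this
  have h32 : ((z ⬝ᵥ z : ℤ) : ℝ) = 32 := by linarith
  exact_mod_cast h32

/-- Inner products of elements of `M`. -/
theorem inner_mem_of_mem_M {x y : EuclideanSpace ℝ (Fin 24)} (hx : x ∈ M) (hy : y ∈ M) :
    inner ℝ x y ∈ ({-1, -1 / 2, -1 / 4, 0, 1 / 4, 1 / 2, 1} : Set ℝ) := by
  obtain ⟨z, hz, hz2, rfl⟩ := exists_eq_leechPoint hx
  obtain ⟨z', hz', hz2', rfl⟩ := exists_eq_leechPoint hy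
  have := hz.dotProduct_mem hz' hz2 hz2'
  rw [inner_leechPoint]
  simp only [Finset.mem_insert, Finset.mem_singleton] at this
  simp only [Set.mem_insert_iff, Set.mem_singleton_iff]
  rcases this with h | h | h | h | h | h | h <;> rw [h] <;> norm_num

/-! ### Construction and counting of the set `K`. -/

/-- The vector with entries `±c` on `t`, negative on `s`, and `0` elsewhere. -/
def signedVector (c : ℤ) (q : (_ : Finset (Fin 24)) × Finset (Fin 24)) (i : Fin 24) : ℤ :=
  if i ∈ q.1 then if i ∈ q.2 then -c else c else 0

theorem signedVector_eq {c : ℤ} {q : (_ : Finset (Fin 24)) × Finset (Fin 24)} (hq : q.2 ⊆ q.1)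
    (i : Fin 24) :
    signedVector c q i = c * (if i ∈ q.1 then 1 else 0) - 2 * c * if i ∈ q.2 then 1 else 0 := by
  have := @hq i
  unfold signedVector
  split_ifs <;> first | (simp_all; done) | ring

theorem sum_signedVector {c : ℤ} {q : (_ : Finset (Fin 24)) × Finset (Fin 24)} (hq : q.2 ⊆ q.1) :
    ∑ i, signedVector c q i = c * q.1.card - 2 * c * q.2.card := by
  rw [Finset.sum_congr rfl fun i _ => signedVector_eq hq i, Finset.sum_sub_distrib,
    ← Finset.mul_sum, ← Finset.mul_sum]
  simp

theorem signedVector_dotProduct_self (c : ℤ) (q : (_ : Finset (Fin 24)) × Finset (Fin 24)) :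
    signedVector c q ⬝ᵥ signedVector c q = c ^ 2 * q.1.card := by
  have : ∀ i, signedVector c q i * signedVector c q i = c ^ 2 * if i ∈ q.1 then 1 else 0 := by
    intro i
    unfold signedVector
    split_ifs <;> ring
  rw [dotProduct, Finset.sum_congr rfl fun i _ => this i, ← Finset.mul_sum]
  simp

theorem signedVector_injOn {c : ℤ} (hc : 0 < c) {q q' : (_ : Finset (Fin 24)) × Finset (Fin 24)}
    (hq : q.2 ⊆ q.1) (hq' : q'.2 ⊆ q'.1) (h : signedVector c q = signedVector c q') : q = q' := by
  obtain ⟨t, s⟩ := q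
  obtain ⟨t', s'⟩ := q'
  have key : ∀ i, (i ∈ t ↔ i ∈ t') ∧ (i ∈ s ↔ i ∈ s') := by
    intro i
    have h1 := congrFun h i
    have h2 := @hq i
    have h3 := @hq' i
    simp only [signedVector] at h1 h2 h3
    split_ifs at h1 <;> first | omega | simp_all
  obtain rfl : t = t' := Finset.ext fun i => (key i).1
  obtain rfl : s = s' := Finset.ext fun i => (key i).2
  rfl

/-- The positions of the bits set in `w`. -/
def support (w : ℕ) : Finset (Fin 24) := {i | w.testBit i}

theorem bit_eq_ite (w : ℕ) (i : Fin 24) : bit w i = if i ∈ support w then 1 else 0 := by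
  simp [bit, support]

theorem card_support (w : ℕ) : (support w).card = weight w := by
  have := sum_bit w
  simp only [bit_eq_ite, Finset.sum_ite_mem, Finset.univ_inter, Finset.sum_const, nsmul_one] at this
  exact_mod_cast this

theorem support_injOn {v w : ℕ} (hv : v < 2 ^ 24) (hw : w < 2 ^ 24) (h : support v = support w) :
    v = w :=
  bit_injOn hv hw (funext fun i => by rw [bit_eq_ite, bit_eq_ite, h])

/-- The alternating sum over the subsets of a nonempty set vanishes. -/
theorem card_powerset_filter_even {α : Type*} {t : Finset α} (ht : t.Nonempty) :
    2 * (t.powerset.filter fun s => Even s.card).card = 2 ^ t.card := by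
  classical
  have h1 := Finset.sum_powerset_neg_one_pow_card_of_nonempty ht
  have h2 : ∀ s : Finset α, 2 * (if Even s.card then (1 : ℤ) else 0) = 1 + (-1) ^ s.card := by
    intro s
    split_ifs with h
    · rw [h.neg_one_pow]; norm_num
    · rw [(Nat.not_even_iff_odd.1 h).neg_one_pow]; norm_num
  have h3 : (2 * (t.powerset.filter fun s => Even s.card).card : ℤ) = 2 ^ t.card := by
    rw [← Finset.sum_boole, Finset.mul_sum, Finset.sum_congr rfl fun s _ => h2 s,
      Finset.sum_add_distrib, h1, Finset.sum_const, Finset.card_powerset]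
    simp
  exact_mod_cast h3

/-- Minimal vectors of shape `(±4, ±4, 0, …, 0)`. -/
def pairVectors : Finset (Fin 24 → ℤ) :=
  (((Finset.univ.powersetCard 2).filter fun t : Finset (Fin 24) => (0 ∈ t ↔ 1 ∈ t)).sigma
    fun t => t.powerset).image (signedVector 4)

/-- Minimal vectors of shape `(±2, …, ±2, 0, …, 0)`. -/
noncomputable def octadVectors : Finset (Fin 24 → ℤ) :=
  ((octads.toFinset.image support).sigma
    fun t => t.powerset.filter fun s => Even s.card).image (signedVector 2)

/-- The vector with entries `±1`, apart from an entry `±3` in position `q.2`. -/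
def oddVector (q : ℕ × Fin 24) (i : Fin 24) : ℤ :=
  (1 - 2 * bit q.1 i) * if i = q.2 then -3 else 1

/-- Minimal vectors of shape `(±3, ±1, …, ±1)`. -/
def oddVectors : Finset (Fin 24 → ℤ) :=
  ((golayWords 12).toFinset ×ˢ (Finset.univ.filter fun p : Fin 24 => p ≠ 0 ∧ p ≠ 1)).image oddVector

set_option linter.constructorNameAsVariable false in
theorem card_pairVectors : pairVectors.card = 928 := by
  rw [pairVectors, Finset.card_image_of_injOn, Finset.card_sigma,
    Finset.sum_congr rfl (g := fun _ => 4)]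
  -- There are `1 + C(22, 2) = 232` pairs, each with 4 sign patterns.
  · rw [Finset.sum_const]
    decide +kernel
  · intro t ht
    rw [Finset.card_powerset, (Finset.mem_powersetCard.1 (Finset.mem_filter.1 ht).1).2]
    rfl
  · intro q hq q' hq' h
    simp only [Finset.coe_sigma, Set.mem_sigma_iff, Finset.mem_coe, Finset.mem_powerset] at hq hq'
    exact signedVector_injOn (by norm_num) hq.2 hq'.2 h

theorem card_octadVectors : octadVectors.card = 52096 := by
  rw [octadVectors, Finset.card_image_of_injOn, Finset.card_sigma,
    Finset.sum_congr rfl (g := fun _ => 128)]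
  · rw [Finset.sum_const, Finset.card_image_of_injOn, List.toFinset_card_of_nodup nodup_octads,
      length_octads]
    · norm_num
    · intro v hv w hw h
      simp only [List.coe_toFinset, Set.mem_ofPred_eq, mem_octads] at hv hw
      exact support_injOn (golayWords_lt v hv.1) (golayWords_lt w hw.1) h
  · intro t ht
    obtain ⟨w, hw, rfl⟩ := Finset.mem_image.1 ht
    rw [List.mem_toFinset, mem_octads] at hw
    have h8 : (support w).card = 8 := by rw [card_support, hw.2.1]
    have := card_powerset_filter_even (t := support w) (Finset.card_pos.1 (by omega))
    rw [h8] at this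
    omega
  · intro q hq q' hq' h
    simp only [Finset.coe_sigma, Set.mem_sigma_iff, Finset.mem_coe, Finset.mem_filter,
      Finset.mem_powerset] at hq hq'
    exact signedVector_injOn (by norm_num) hq.2.1 hq'.2.1 h

theorem card_oddVectors : oddVectors.card = 90112 := by
  rw [oddVectors, Finset.card_image_of_injOn, Finset.card_product,
    List.toFinset_card_of_nodup (nodup_golayWords 12 le_rfl), length_golayWords]
  · rw [show (Finset.univ.filter fun p : Fin 24 => p ≠ 0 ∧ p ≠ 1).card = 22 by decide +kernel]
    norm_num
  · rintro ⟨v, p⟩ hv ⟨w, p'⟩ hw h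
    simp only [Finset.coe_product, Set.mem_prod, List.coe_toFinset, Set.mem_ofPred_eq] at hv hw
    have key : ∀ i, bit v i = bit w i ∧ (i = p ↔ i = p') := by
      intro i
      have h1 := congrFun h i
      simp only [oddVector] at h1
      rcases bit_eq_zero_or_one v i with h2 | h2 <;> rcases bit_eq_zero_or_one w i with h3 | h3 <;>
        rw [h2, h3] at h1 ⊢ <;> split_ifs at h1 <;> simp_all
    rw [Prod.mk.injEq]
    exact ⟨bit_injOn (golayWords_lt v hv.1) (golayWords_lt w hw.1) (funext fun i => (key i).1),
      ((key p).2.1 rfl)⟩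

attribute [irreducible] pairVectors octadVectors oddVectors

set_option linter.constructorNameAsVariable false in
theorem pairVectors_spec {z : Fin 24 → ℤ} (hz : z ∈ pairVectors) :
    IsLeechVector z ∧ z ⬝ᵥ z = 32 ∧ |z 0| = |z 1| ∧ ∀ i, 4 ∣ z i := by
  rw [pairVectors, Finset.mem_image] at hz
  obtain ⟨⟨t, s⟩, hq, rfl⟩ := hz
  simp only [Finset.mem_sigma, Finset.mem_filter, Finset.mem_powersetCard, Finset.mem_powerset,
    Finset.subset_univ, true_and] at hq
  obtain ⟨⟨ht, h01⟩, hs⟩ := hq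
  refine ⟨LeechForm.isLeechVector (m := 0) (w := 0) (y := signedVector 1 ⟨t, s⟩)
    ⟨zero_mem_golayWords 12, fun i => ?_, ?_⟩, ?_, ?_, fun i => ?_⟩
  · rw [bit_zero]
    unfold signedVector
    split_ifs <;> ring
  · rw [sum_signedVector hs, ht, Int.ModEq]
    push_cast
    omega
  · rw [signedVector_dotProduct_self, ht]
    norm_num
  · simp only [signedVector]
    split_ifs <;> simp_all
  · unfold signedVector
    split_ifs <;> norm_num

theorem octadVectors_spec {z : Fin 24 → ℤ} (hz : z ∈ octadVectors) :
    IsLeechVector z ∧ z ⬝ᵥ z = 32 ∧ |z 0| = |z 1| ∧ (∀ i, 2 ∣ z i) ∧ ∃ i, ¬ 4 ∣ z i := by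
  rw [octadVectors, Finset.mem_image] at hz
  obtain ⟨⟨t, s⟩, hq, rfl⟩ := hz
  simp only [Finset.mem_sigma, Finset.mem_filter, Finset.mem_powerset, Finset.mem_image,
    List.mem_toFinset, mem_octads] at hq
  obtain ⟨⟨w, ⟨hw, h8, h01⟩, rfl⟩, hs, k, hk⟩ := hq
  have ht : (support w).card = 8 := by rw [card_support, h8]
  refine ⟨LeechForm.isLeechVector (m := 0) (w := w) (y := fun i => - if i ∈ s then 1 else 0)
    ⟨hw, fun i => ?_, ?_⟩, ?_, ?_, fun i => ?_, ?_⟩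
  · rw [bit_eq_ite, signedVector_eq hs]
    ring
  · rw [sum_signedVector hs, ht, hk, Int.ModEq]
    push_cast
    omega
  · rw [signedVector_dotProduct_self, ht]
    norm_num
  · have : (0 : Fin 24) ∈ support w ↔ (1 : Fin 24) ∈ support w := by simp [support, h01]
    simp only [signedVector]
    split_ifs <;> simp_all
  · unfold signedVector
    split_ifs <;> norm_num
  · obtain ⟨i, hi⟩ := Finset.card_pos.1 (show 0 < (support w).card by omega)
    refine ⟨i, ?_⟩
    simp only [signedVector, hi, if_true]
    split_ifs <;> norm_num

theorem oddVectors_spec {z : Fin 24 → ℤ} (hz : z ∈ oddVectors) :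
    IsLeechVector z ∧ z ⬝ᵥ z = 32 ∧ |z 0| = |z 1| ∧ ¬ 2 ∣ z 0 := by
  rw [oddVectors, Finset.mem_image] at hz
  obtain ⟨⟨w, p⟩, hq, rfl⟩ := hz
  simp only [Finset.mem_product, Finset.mem_filter, List.mem_toFinset, Finset.mem_univ,
    true_and] at hq
  obtain ⟨hw, hp0, hp1⟩ := hq
  have hb := bit_eq_zero_or_one w
  refine ⟨LeechForm.isLeechVector (m := 1) (w := w)
    -- Off `p`, `1 - 2b = 1 + 2b - 4b`; at `p`, `-3(1 - 2b) = 1 + 2b + 4(b - 1)`.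
    (y := fun i => - bit w i + if i = p then 2 * bit w i - 1 else 0) ⟨hw, fun i => ?_, ?_⟩,
      ?_, ?_, ?_⟩
  · simp only [oddVector]
    split_ifs <;> ring
  · have h1 : ∀ i, oddVector (w, p) i =
        1 - 2 * bit w i + if i = p then -4 * (1 - 2 * bit w i) else 0 := by
      intro i
      simp only [oddVector]
      split_ifs <;> ring
    rw [Finset.sum_congr rfl fun i _ => h1 i, Finset.sum_add_distrib, Finset.sum_sub_distrib,
      ← Finset.mul_sum, sum_bit, Finset.sum_ite_eq' Finset.univ p, if_pos (Finset.mem_univ p)]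
    have := four_dvd_weight hw
    simp only [Finset.sum_const, Finset.card_univ, Fintype.card_fin, Int.ModEq, nsmul_eq_mul, mul_one,
      Nat.cast_ofNat]
    omega
  · have h1 : ∀ i, oddVector (w, p) i * oddVector (w, p) i = 1 + if i = p then 8 else 0 := by
      intro i
      simp only [oddVector]
      rcases hb i with h | h <;> rw [h] <;> split_ifs <;> norm_num
    rw [dotProduct, Finset.sum_congr rfl fun i _ => h1 i, Finset.sum_add_distrib,
      Finset.sum_ite_eq' Finset.univ p, if_pos (Finset.mem_univ p)]
    simp
  · simp only [oddVector, if_neg hp0.symm, if_neg hp1.symm]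
    rcases hb 0 with h | h <;> rcases hb 1 with h' | h' <;> rw [h, h'] <;> norm_num
  · simp only [oddVector, if_neg hp0.symm]
    omega

/-- Representatives of the elements of `M` whose first two coordinates agree up to sign. -/
noncomputable def balancedVectors : Finset (Fin 24 → ℤ) :=
  pairVectors ∪ octadVectors ∪ oddVectors

theorem card_balancedVectors : balancedVectors.card = 143136 := by
  rw [balancedVectors, Finset.card_union_of_disjoint, Finset.card_union_of_disjoint,
    card_pairVectors, card_octadVectors, card_oddVectors]
  -- Divisibility of the coordinates by 2 and by 4 separates the three shapes.
  · rw [Finset.disjoint_left]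
    intro z hz hz'
    obtain ⟨i, hi⟩ := (octadVectors_spec hz').2.2.2.2
    exact hi ((pairVectors_spec hz).2.2.2 i)
  · rw [Finset.disjoint_left]
    intro z hz hz'
    refine (oddVectors_spec hz').2.2.2 ?_
    rcases Finset.mem_union.1 hz with hz | hz
    · exact (by norm_num : (2 : ℤ) ∣ 4).trans ((pairVectors_spec hz).2.2.2 0)
    · exact (octadVectors_spec hz).2.2.2.1 0

attribute [irreducible] balancedVectors

theorem balancedVectors_spec {z : Fin 24 → ℤ} (hz : z ∈ balancedVectors) :
    IsLeechVector z ∧ z ⬝ᵥ z = 32 ∧ |z 0| = |z 1| := by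
  rw [balancedVectors, Finset.mem_union, Finset.mem_union] at hz
  rcases hz with (hz | hz) | hz
  · obtain ⟨h1, h2, h3, -⟩ := pairVectors_spec hz
    exact ⟨h1, h2, h3⟩
  · obtain ⟨h1, h2, h3, -⟩ := octadVectors_spec hz
    exact ⟨h1, h2, h3⟩
  · obtain ⟨h1, h2, h3, -⟩ := oddVectors_spec hz
    exact ⟨h1, h2, h3⟩

/-- A set of elements of `M` whose first two coordinates agree up to sign. -/
def balancedPoints : Set (EuclideanSpace ℝ (Fin 24)) := leechPoint '' balancedVectors

theorem ncard_balancedPoints : balancedPoints.ncard = 143136 := by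
  rw [balancedPoints, Set.ncard_image_of_injective _ leechPoint_injective, Set.ncard_coe_finset,
    card_balancedVectors]

theorem balancedPoints_subset_M : balancedPoints ⊆ M := by
  rintro _ ⟨z, hz, rfl⟩
  obtain ⟨h1, h2, -⟩ := balancedVectors_spec hz
  exact leechPoint_mem_M h1 h2

theorem abs_eq_of_mem_balancedPoints {x : EuclideanSpace ℝ (Fin 24)} (hx : x ∈ balancedPoints) :
    |x 0| = |x 1| := by
  obtain ⟨z, hz, rfl⟩ := hx
  have h := (balancedVectors_spec hz).2.2
  simp only [leechPoint, abs_div]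
  rw [← Int.cast_abs, ← Int.cast_abs, h]

/-! ### Rank bounds for sets with few inner products. -/

theorem card_basisIndex : Fintype.card BasisIndex = 324 := by
  have h2 : Fintype.card {p : Fin 24 × Fin 24 // p.1 < p.2} = 276 := by
    rw [Fintype.card_subtype]; decide +kernel
  simp [h2]

/-- The square of an inner product, as an inner product of vectors of quadratic monomials. -/
theorem sum_sq_eq (a b : Fin 24 → ℝ) :
    (∑ i, a i * b i) ^ 2 = ∑ i, a i ^ 2 * b i ^ 2 +
      2 * ∑ p : {p : Fin 24 × Fin 24 // p.1 < p.2},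
        (a p.1.1 * a p.1.2) * (b p.1.1 * b p.1.2) := by
  set f : Fin 24 × Fin 24 → ℝ := fun p => (a p.1 * b p.1) * (a p.2 * b p.2) with hf
  have h1 : (∑ i, a i * b i) ^ 2 = ∑ p, f p := by
    rw [sq, Finset.sum_mul_sum, ← Finset.univ_product_univ, Finset.sum_product]
  have h2 : ∑ p : {p : Fin 24 × Fin 24 // p.1 < p.2},
      (a p.1.1 * a p.1.2) * (b p.1.1 * b p.1.2) = ∑ p with p.1 < p.2, f p := by
    rw [← Finset.sum_subtype_eq_sum_filter, Finset.subtype_univ]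
    exact Finset.sum_congr rfl fun p _ => by simp only [hf]; ring
  have h3 : ∑ p with p.2 < p.1, f p = ∑ p with p.1 < p.2, f p := by
    refine Finset.sum_equiv (Equiv.prodComm _ _) (by simp) fun p _ => ?_
    simp only [hf, Equiv.prodComm_apply, Prod.fst_swap, Prod.snd_swap]
    ring
  have h4 : ∑ p with p.1 = p.2, f p = ∑ i, a i ^ 2 * b i ^ 2 := by
    refine Finset.sum_nbij' (fun p => p.1) (fun i => (i, i)) (by simp) (by simp) ?_ (by simp) ?_
    · rintro ⟨i, j⟩ h
      simp only [Finset.mem_filter, Finset.mem_univ, true_and] at h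
      simp [h]
    · rintro ⟨i, j⟩ h
      simp only [Finset.mem_filter, Finset.mem_univ, true_and] at h
      subst h
      simp only [hf]
      ring
  have h5 : ∀ p, f p = (if p.1 = p.2 then f p else 0) + (if p.1 < p.2 then f p else 0) +
      if p.2 < p.1 then f p else 0 := by
    intro p
    rcases lt_trichotomy p.1 p.2 with h | h | h
    · simp [h, h.ne, h.not_gt]
    · simp [h]
    · simp [h, h.ne', h.not_gt]
  rw [h1, h2, Finset.sum_congr rfl fun p _ => h5 p, Finset.sum_add_distrib,
    Finset.sum_add_distrib, ← Finset.sum_filter, ← Finset.sum_filter, ← Finset.sum_filter, h3, h4]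
  ring

/-- An integer matrix that factors through `κ` over `ℝ` and is invertible modulo `2` has at most
`#κ` rows. -/
theorem card_le_of_factor {ι κ : Type*} [Fintype ι] [DecidableEq ι] [Fintype κ]
    (U : Matrix ι κ ℝ) (V : Matrix κ ι ℝ) (N : Matrix ι ι ℤ)
    (h : U * V = N.map (Int.cast : ℤ → ℝ))
    (hN : (N.map (Int.cast : ℤ → ZMod 2)).det ≠ 0) : Fintype.card ι ≤ Fintype.card κ := by
  have h1 : N.det ≠ 0 := by
    intro h0
    apply hN
    have := (Int.castRingHom (ZMod 2)).map_det N
    rw [h0, map_zero] at this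
    exact this.symm
  have h2 : IsUnit (U * V) := by
    rw [Matrix.isUnit_iff_isUnit_det, isUnit_iff_ne_zero, h]
    have := (Int.castRingHom ℝ).map_det N
    intro h0
    apply h1
    have h3 : ((N.det : ℤ) : ℝ) = 0 := this.trans h0
    exact_mod_cast h3
  rw [← Matrix.rank_of_isUnit _ h2]
  exact (Matrix.rank_mul_le_left U V).trans (Matrix.rank_le_card_width U)

theorem inner_eq_sum (x y : EuclideanSpace ℝ (Fin 24)) : inner ℝ x y = ∑ i, x i * y i := by
  simp only [PiLp.inner_apply, RCLike.inner_apply, conj_trivial]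
  exact Finset.sum_congr rfl fun i _ => mul_comm _ _

/-- The polynomial `p(t) = (4t - 1)(4t - 2)/6` takes the values 1, 2, 0, 0 at `t = 1, -1/2, 1/4,
1/2`, so the matrix of `p(⟪x, y⟫)` is the identity modulo 2. It factors through the 324 monomials of
degree 1 and 2, the constant term being absorbed by `∑ yᵢ² = 1`. -/
theorem card_le_of_inner_mem (S : Finset (EuclideanSpace ℝ (Fin 24))) (h1 : ∀ x ∈ S, ‖x‖ = 1)
    (h : ∀ x ∈ S, ∀ y ∈ S, x ≠ y → inner ℝ x y ∈ ({-1 / 2, 1 / 4, 1 / 2} : Set ℝ)) :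
    S.card ≤ 324 := by
  classical
  let U : Matrix S BasisIndex ℝ := fun x => Sum.elim (fun i => (8 * x.1 i ^ 2 + 1) / 3)
    (Sum.elim (fun i => -2 * x.1 i) fun p => 16 / 3 * (x.1 p.1.1 * x.1 p.1.2))
  let V : Matrix BasisIndex S ℝ := fun k y => Sum.elim (fun i => y.1 i ^ 2)
    (Sum.elim (fun i => y.1 i) fun p => y.1 p.1.1 * y.1 p.1.2) k
  let N : Matrix S S ℤ := fun x y => if x = y then 1 else if inner ℝ x.1 y.1 = -1 / 2 then 2 else 0
  rw [← card_basisIndex, ← Fintype.card_coe S]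
  refine card_le_of_factor U V N ?_ ?_
  · ext x y
    have hUV : (U * V) x y = (4 * inner ℝ x.1 y.1 - 1) * (4 * inner ℝ x.1 y.1 - 2) / 6 := by
      have hy : ∑ i, y.1 i ^ 2 = 1 := by
        rw [← EuclideanSpace.real_norm_sq_eq, h1 y.1 y.2, one_pow]
      have e : (4 * inner ℝ x.1 y.1 - 1) * (4 * inner ℝ x.1 y.1 - 2) / 6 =
          8 / 3 * (∑ i, x.1 i * y.1 i) ^ 2 - 2 * (∑ i, x.1 i * y.1 i) + 1 / 3 * ∑ i, y.1 i ^ 2 := by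
        rw [hy, inner_eq_sum]
        ring
      rw [e, sum_sq_eq, Matrix.mul_apply, Fintype.sum_sum_type, Fintype.sum_sum_type]
      simp only [U, V, Sum.elim_inl, Sum.elim_inr, mul_add, Finset.mul_sum]
      rw [show ∀ a b c d : ℝ, a + b - c + d = a - c + d + b from fun _ _ _ _ => by ring,
        ← add_assoc, ← Finset.sum_sub_distrib, ← Finset.sum_add_distrib, ← Finset.sum_add_distrib]
      congr 1
      · exact Finset.sum_congr rfl fun i _ => by ring
      · exact Finset.sum_congr rfl fun i _ => by ring
    rw [hUV, Matrix.map_apply]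
    simp only [N]
    split_ifs with hxy ht
    · rw [hxy, real_inner_self_eq_norm_sq, h1 y.1 y.2]
      norm_num
    · rw [ht]
      norm_num
    · have := h x.1 x.2 y.1 y.2 (fun h => hxy (Subtype.ext h))
      simp only [Set.mem_insert_iff, Set.mem_singleton_iff] at this
      rcases this with h | h | h
      · exact absurd h ht
      · rw [h]; norm_num
      · rw [h]; norm_num
  · have : N.map (Int.cast : ℤ → ZMod 2) = 1 := by
      ext x y
      rw [Matrix.map_apply, Matrix.one_apply]
      simp only [N]
      split_ifs
      · simp
      · rfl
      · simp
    rw [this, Matrix.det_one]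
    exact one_ne_zero

/-- Twice the Gram matrix is `J - I` modulo 2, with `J` the all-ones matrix. For an even number of
points `J² = 0`, so `(J - I)² = I`, while the rank is at most 24. Hence 26 points are impossible. -/
theorem card_le_of_inner_eq_half (S : Finset (EuclideanSpace ℝ (Fin 24))) (h1 : ∀ x ∈ S, ‖x‖ = 1)
    (h : ∀ x ∈ S, ∀ y ∈ S, x ≠ y → inner ℝ x y ∈ ({-1 / 2, 1 / 2} : Set ℝ)) :
    S.card ≤ 25 := by
  classical
  by_contra! hS
  obtain ⟨P, hPS, hP⟩ := Finset.exists_subset_card_eq (show 26 ≤ S.card from hS)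
  let U : Matrix P (Fin 24) ℝ := fun x i => 2 * x.1 i
  let V : Matrix (Fin 24) P ℝ := fun i y => y.1 i
  let N : Matrix P P ℤ := fun x y => if x = y then 2 else if inner ℝ x.1 y.1 = -1 / 2 then -1 else 1
  have : Fintype.card P ≤ Fintype.card (Fin 24) := by
    refine card_le_of_factor U V N ?_ ?_
    · ext x y
      have hUV : (U * V) x y = 2 * inner ℝ x.1 y.1 := by
        rw [Matrix.mul_apply, inner_eq_sum, Finset.mul_sum]
        exact Finset.sum_congr rfl fun i _ => mul_assoc _ _ _
      rw [hUV, Matrix.map_apply]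
      simp only [N]
      split_ifs with hxy ht
      · rw [hxy, real_inner_self_eq_norm_sq, h1 y.1 (hPS y.2)]
        norm_num
      · rw [ht]
        norm_num
      · have := h x.1 (hPS x.2) y.1 (hPS y.2) (fun h => hxy (Subtype.ext h))
        simp only [Set.mem_insert_iff, Set.mem_singleton_iff] at this
        rcases this with h | h
        · exact absurd h ht
        · rw [h]; norm_num
    · have hN : N.map (Int.cast : ℤ → ZMod 2) = Matrix.of (fun _ _ => 1) - 1 := by
        ext x y
        rw [Matrix.map_apply, Matrix.sub_apply, Matrix.of_apply, Matrix.one_apply]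
        simp only [N]
        split_ifs <;> decide
      have hJ : (Matrix.of (fun _ _ => 1) : Matrix P P (ZMod 2)) * Matrix.of (fun _ _ => 1) = 0 := by
        ext x y
        simp only [Matrix.mul_apply, Matrix.of_apply, mul_one, Finset.sum_const, Finset.card_univ,
          Fintype.card_coe, hP, Matrix.zero_apply]
        decide
      have hinv : (N.map (Int.cast : ℤ → ZMod 2)) * (N.map (Int.cast : ℤ → ZMod 2)) = 1 := by
        rw [hN, sub_mul, mul_sub, mul_sub, hJ, mul_one, one_mul, one_mul]
        ext x y
        simp only [Matrix.sub_apply, Matrix.zero_apply, Matrix.of_apply]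
        generalize (1 : Matrix P P (ZMod 2)) x y = a
        revert a
        decide
      intro h0
      have := congrArg Matrix.det hinv
      rw [Matrix.det_mul, h0, zero_mul, Matrix.det_one] at this
      exact zero_ne_one this
  simp [hP] at this

/-- A set of unit vectors with inner products `-1`, `-1/2`, `1/4`, `1/2` has at most `350`
elements. -/
theorem card_le_of_inner_mem_of_antipodal (S : Finset (EuclideanSpace ℝ (Fin 24)))
    (h1 : ∀ x ∈ S, ‖x‖ = 1)
    (h : ∀ x ∈ S, ∀ y ∈ S, x ≠ y → inner ℝ x y ∈ ({-1, -1 / 2, 1 / 4, 1 / 2} : Set ℝ)) :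
    S.card ≤ 350 := by
  classical
  -- `A` is a largest subset without antipodal pairs, so the antipode of every point outside `A`
  -- lies in `A`.
  obtain ⟨A, hA, hmax⟩ := Finset.exists_max_image
    (S.powerset.filter fun A => ∀ x ∈ A, -x ∉ A) Finset.card ⟨∅, by simp⟩
  simp only [Finset.mem_filter, Finset.mem_powerset] at hA hmax
  obtain ⟨hAS, hAneg⟩ := hA
  have hne : ∀ x ∈ S, -x ≠ x := by
    intro x hx h0
    have h2 : inner ℝ x (-x) = inner ℝ x x := by rw [h0]
    rw [inner_neg_right, real_inner_self_eq_norm_sq, h1 x hx] at h2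
    norm_num at h2
  have hanti : ∀ x ∈ S, ∀ y ∈ S, inner ℝ x y = -1 → x = -y := by
    intro x hx y hy hxy
    have : inner ℝ x (-y) = 1 := by rw [inner_neg_right, hxy, neg_neg]
    exact (inner_eq_one_iff_of_norm_eq_one (h1 x hx) (by rw [norm_neg, h1 y hy])).1 this
  have hR : ∀ x ∈ S \ A, -x ∈ A := by
    intro x hx
    rw [Finset.mem_sdiff] at hx
    by_contra hxA
    have := hmax (insert x A) ⟨Finset.insert_subset hx.1 hAS, ?_⟩
    · rw [Finset.card_insert_of_notMem hx.2] at this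
      omega
    · intro y hy
      rw [Finset.mem_insert] at hy ⊢
      rcases hy with rfl | hy
      · rintro (h | h)
        · exact hne y hx.1 h
        · exact hxA h
      · rintro (h | h)
        · exact hxA (by rw [← h, neg_neg]; exact hy)
        · exact hAneg y hy h
  have hA324 : A.card ≤ 324 := by
    refine card_le_of_inner_mem A (fun x hx => h1 x (hAS hx)) fun x hx y hy hxy => ?_
    rcases h x (hAS hx) y (hAS hy) hxy with h | h
    · have := hanti x (hAS hx) y (hAS hy) h
      exact absurd (this ▸ hx) (hAneg y hy)
    · exact h
  have hR25 : (S \ A).card ≤ 25 := by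
    refine card_le_of_inner_eq_half _ (fun x hx => h1 x (Finset.mem_sdiff.1 hx).1)
      fun x hx y hy hxy => ?_
    have hxS := (Finset.mem_sdiff.1 hx).1
    have hyS := (Finset.mem_sdiff.1 hy).1
    have hxy' : x ≠ -y := fun h => (Finset.mem_sdiff.1 hx).2 (h ▸ hR y hy)
    have a := h x hxS y hyS hxy
    have b := h x hxS (-y) (hAS (hR y hy)) hxy'
    rw [inner_neg_right] at b
    have c : inner ℝ x y ≠ -1 := fun h => hxy' (hanti x hxS y hyS h)
    simp only [Set.mem_insert_iff, Set.mem_singleton_iff] at a b ⊢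
    rcases a with a | a | a | a
    · exact absurd a c
    · exact Or.inl a
    -- Inner product `1/4` with `y` would be `-1/4` with `-y ∈ S`, which is not allowed.
    · rw [a] at b
      norm_num at b
    · exact Or.inr a
  -- The two bounds add up to `324 + 25 = 349`.
  have := Finset.card_sdiff_add_card_eq_card hAS
  omega

/-! ### Metric properties of `Φ` on `M`. -/

variable (b : OrthonormalBasis BasisIndex ℝ (EuclideanSpace ℝ (Fin 324)))

/-- The coordinates of `Φ x`. -/
noncomputable def phiCoord (x : EuclideanSpace ℝ (Fin 24)) : BasisIndex → ℝ :=
  Sum.elim (fun i => 2 / √5 * x i ^ 2)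
    (Sum.elim (fun i => 1 / √5 * x i) fun p => 2 * √2 / √5 * (x p.1.1 * x p.1.2))

theorem Phi_eq_sum (x : EuclideanSpace ℝ (Fin 24)) : Phi b x = ∑ k, phiCoord x k • b k := by
  rw [Fintype.sum_sum_type, Fintype.sum_sum_type]
  simp only [Phi, phiCoord, Sum.elim_inl, Sum.elim_inr, Finset.smul_sum, smul_smul, add_assoc]

theorem inner_basis_Phi (x : EuclideanSpace ℝ (Fin 24)) (k : BasisIndex) :
    inner ℝ (b k) (Phi b x) = phiCoord x k := by
  rw [Phi_eq_sum, b.orthonormal.inner_right_fintype]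

/-- The `e` and `g` coordinates together give `4/5` of the squared inner product, and the `f`
coordinates give `1/5` of the inner product. -/
theorem inner_Phi (x y : EuclideanSpace ℝ (Fin 24)) :
    inner ℝ (Phi b x) (Phi b y) = (4 * inner ℝ x y ^ 2 + inner ℝ x y) / 5 := by
  have h5 : (√5 : ℝ) ^ 2 = 5 := Real.sq_sqrt (by norm_num)
  have h2 : (√2 : ℝ) ^ 2 = 2 := Real.sq_sqrt (by norm_num)
  have h0 : (√5 : ℝ) ≠ 0 := by positivity
  rw [← b.sum_inner_mul_inner, inner_eq_sum]
  simp only [real_inner_comm (b _) (Phi b x), inner_basis_Phi]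
  have e : (4 * (∑ i, x i * y i) ^ 2 + ∑ i, x i * y i) / 5 =
      4 / 5 * (∑ i, x i * y i) ^ 2 + 1 / 5 * ∑ i, x i * y i := by ring
  rw [e, sum_sq_eq, Fintype.sum_sum_type, Fintype.sum_sum_type]
  simp only [phiCoord, Sum.elim_inl, Sum.elim_inr, mul_add, Finset.mul_sum]
  rw [← add_assoc]
  refine Eq.trans ?_ (add_right_comm _ _ _)
  congr 1
  · congr 1
    · refine Finset.sum_congr rfl fun i _ => ?_
      field_simp
      rw [h5]
      ring
    · refine Finset.sum_congr rfl fun i _ => ?_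
      field_simp
      rw [h5]
      ring
  · refine Finset.sum_congr rfl fun i _ => ?_
    field_simp
    rw [h5, h2]
    ring

theorem Phi_injective : Function.Injective (Phi b) := by
  intro x y h
  ext i
  have h1 := inner_basis_Phi b x (Sum.inr (Sum.inl i))
  rw [h, inner_basis_Phi] at h1
  simp only [phiCoord, Sum.elim_inl, Sum.elim_inr] at h1
  have h0 : 1 / (√5 : ℝ) ≠ 0 := by positivity
  exact (mul_left_cancel₀ h0 h1).symm

theorem norm_Phi {x : EuclideanSpace ℝ (Fin 24)} (hx : x ∈ M) : ‖Phi b x‖ = 1 := by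
  have := inner_Phi b x x
  rw [real_inner_self_eq_norm_sq, real_inner_self_eq_norm_sq, hx.2] at this
  refine (pow_eq_one_iff_of_nonneg (norm_nonneg _) two_ne_zero).1 (this.trans (by norm_num))

theorem dist_Phi_sq {x y : EuclideanSpace ℝ (Fin 24)} (hx : x ∈ M) (hy : y ∈ M) :
    dist (Phi b x) (Phi b y) ^ 2 = 2 - 2 * ((4 * inner ℝ x y ^ 2 + inner ℝ x y) / 5) := by
  rw [dist_eq_norm, norm_sub_sq_real, norm_Phi b hx, norm_Phi b hy, inner_Phi]
  ring

theorem dist_Phi_le {x y : EuclideanSpace ℝ (Fin 24)} (hx : x ∈ M) (hy : y ∈ M) :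
    dist (Phi b x) (Phi b y) ≤ √2 := by
  refine Real.le_sqrt_of_sq_le ?_
  rw [dist_Phi_sq b hx hy]
  have := inner_mem_of_mem_M hx hy
  simp only [Set.mem_insert_iff, Set.mem_singleton_iff] at this
  rcases this with h | h | h | h | h | h | h <;> rw [h] <;> norm_num

theorem diam_Phi_M_le : Metric.diam (Phi b '' M) ≤ √2 := by
  refine Metric.diam_le_of_forall_dist_le (Real.sqrt_nonneg _) ?_
  rintro _ ⟨x, hx, rfl⟩ _ ⟨y, hy, rfl⟩
  exact dist_Phi_le b hx hy

theorem isBounded_Phi_M : Bornology.IsBounded (Phi b '' M) := by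
  refine Metric.isBounded_iff.2 ⟨√2, ?_⟩
  rintro _ ⟨x, hx, rfl⟩ _ ⟨y, hy, rfl⟩
  exact dist_Phi_le b hx hy

theorem inner_mem_of_dist_lt {x y : EuclideanSpace ℝ (Fin 24)} (hx : x ∈ M) (hy : y ∈ M)
    (hxy : x ≠ y) (h : dist (Phi b x) (Phi b y) < √2) :
    inner ℝ x y ∈ ({-1, -1 / 2, 1 / 4, 1 / 2} : Set ℝ) := by
  have h1 : dist (Phi b x) (Phi b y) ^ 2 < 2 := by
    have := pow_lt_pow_left₀ h dist_nonneg two_ne_zero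
    rwa [Real.sq_sqrt (by norm_num)] at this
  rw [dist_Phi_sq b hx hy] at h1
  have := inner_mem_of_mem_M hx hy
  simp only [Set.mem_insert_iff, Set.mem_singleton_iff] at this ⊢
  rcases this with h | h | h | h | h | h | h
  · exact Or.inl h
  · exact Or.inr (Or.inl h)
  · rw [h] at h1; norm_num at h1
  · rw [h] at h1; norm_num at h1
  · exact Or.inr (Or.inr (Or.inl h))
  · exact Or.inr (Or.inr (Or.inr h))
  · exact absurd ((inner_eq_one_iff_of_norm_eq_one hx.2 hy.2).1 h) hxy

/-- Subsets of `Φ(M)` of smaller diameter have at most `350` elements. -/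
theorem encard_le_of_diam_lt {T : Set (EuclideanSpace ℝ (Fin 324))} (hT : T ⊆ Phi b '' M)
    (hd : Metric.diam T < Metric.diam (Phi b '' M)) : T.encard ≤ 350 := by
  classical
  obtain ⟨A, hAM, rfl⟩ := Set.subset_image_iff.1 hT
  rw [(Phi_injective b).encard_image]
  by_contra! hA
  -- `A` is not known to be finite, so a subset of exactly 351 points is taken.
  obtain ⟨S, hSA, hS⟩ := Set.exists_subset_encard_eq (Order.add_one_le_of_lt hA)
  have hfin : S.Finite := Set.finite_of_encard_eq_coe (k := 351) (hS.trans (by norm_num))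
  lift S to Finset (EuclideanSpace ℝ (Fin 24)) using hfin
  rw [Set.encard_coe_eq_coe_finsetCard] at hS
  have hS' : S.card = 351 := by
    have : (S.card : ℕ∞) = ((351 : ℕ) : ℕ∞) := hS.trans (by norm_num)
    exact_mod_cast this
  have := card_le_of_inner_mem_of_antipodal S (fun x hx => (hAM (hSA hx)).2)
    fun x hx y hy hxy => inner_mem_of_dist_lt b (hAM (hSA hx)) (hAM (hSA hy)) hxy
      ((Metric.dist_le_diam_of_mem ((isBounded_Phi_M b).subset hT)
        (Set.mem_image_of_mem _ (hSA hx)) (Set.mem_image_of_mem _ (hSA hy))).trans_lt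
          (hd.trans_le (diam_Phi_M_le b)))
  omega

/-! ### The affine subspace of dimension 322. -/

/-- The points of `M` with `|x k| = |x l|` are mapped into a subspace of codimension `2`. -/
theorem exists_affineSubspace {K : Set (EuclideanSpace ℝ (Fin 24))} {k l : Fin 24} (hkl : k ≠ l)
    (hK : K ⊆ M) (h : ∀ x ∈ K, |x k| = |x l|) (hne : K.Nonempty) :
    ∃ S : AffineSubspace ℝ (EuclideanSpace ℝ (Fin 324)),
      Module.finrank ℝ S.direction = 322 ∧ Phi b '' K ⊆ S := by
  -- On `Φ(K)` the inner product with `u` is 0 because `x_k² = x_l²`, and that with `v` is `2/√5`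
  -- because `∑ xᵢ² = 1`.
  set u : EuclideanSpace ℝ (Fin 324) := b (Sum.inl k) - b (Sum.inl l) with hu
  set v : EuclideanSpace ℝ (Fin 324) := ∑ i : Fin 24, b (Sum.inl i) with hv
  have hbv : ∀ i : Fin 24, inner ℝ (b (Sum.inl i)) v = 1 := by
    intro i
    rw [hv, inner_sum]
    simp [b.inner_eq_ite]
  have huv : inner ℝ u v = 0 := by
    rw [hu, inner_sub_left, hbv, hbv, sub_self]
  have hu0 : u ≠ 0 := by
    intro h0
    exact hkl (Sum.inl_injective (b.toBasis.injective (by simpa using sub_eq_zero.1 h0)))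
  have hv0 : v ≠ 0 := by
    intro h0
    have := hbv k
    rw [h0, inner_zero_right] at this
    exact zero_ne_one this
  have hli : LinearIndependent ℝ ![u, v] := by
    refine linearIndependent_of_ne_zero_of_inner_eq_zero ?_ ?_
    · intro i
      fin_cases i
      · exact hu0
      · exact hv0
    · intro i j hij
      fin_cases i <;> fin_cases j
      · exact absurd rfl hij
      · exact huv
      · exact (real_inner_comm _ _).trans huv
      · exact absurd rfl hij
  set W := Submodule.span ℝ (Set.range ![u, v]) with hW
  have hW2 : Module.finrank ℝ W = 2 := by
    rw [hW, finrank_span_eq_card hli, Fintype.card_fin]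
  have hWp : Module.finrank ℝ Wᗮ = 322 := by
    have := W.finrank_add_finrank_orthogonal
    rw [hW2, finrank_euclideanSpace_fin] at this
    omega
  obtain ⟨x₀, hx₀⟩ := hne
  refine ⟨AffineSubspace.mk' (Phi b x₀) Wᗮ, by rw [AffineSubspace.direction_mk', hWp], ?_⟩
  have hu1 : ∀ x ∈ K, inner ℝ u (Phi b x) = 0 := by
    intro x hx
    rw [hu, inner_sub_left, inner_basis_Phi, inner_basis_Phi]
    simp only [phiCoord, Sum.elim_inl]
    rw [← sq_abs (x k), ← sq_abs (x l), h x hx, sub_self]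
  have hv1 : ∀ x ∈ K, inner ℝ v (Phi b x) = 2 / √5 := by
    intro x hx
    rw [hv, sum_inner]
    simp only [inner_basis_Phi, phiCoord, Sum.elim_inl]
    rw [← Finset.mul_sum, ← EuclideanSpace.real_norm_sq_eq, (hK hx).2, one_pow, mul_one]
  rintro _ ⟨x, hx, rfl⟩
  rw [SetLike.mem_coe, AffineSubspace.mem_mk', vsub_eq_sub, Submodule.mem_orthogonal]
  intro w hw
  induction hw using Submodule.span_induction with
  | mem w h =>
    obtain ⟨i, rfl⟩ := h
    fin_cases i
    · change inner ℝ u _ = 0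
      rw [inner_sub_right, hu1 x hx, hu1 x₀ hx₀, sub_self]
    · change inner ℝ v _ = 0
      rw [inner_sub_right, hv1 x hx, hv1 x₀ hx₀, sub_self]
  | zero => rw [inner_zero_left]
  | add w w' _ _ h h' => rw [inner_add_left, h, h', add_zero]
  | smul a w _ h => rw [inner_smul_left, h, mul_zero]

/-! ### Lower bounds for the Borsuk number. -/

/-- The numbers of which `borsukNumber n` is the least exist. -/
theorem exists_partitionsIntoSmaller (n : ℕ) : ∃ m : ℕ, ∀ A : Set (EuclideanSpace ℝ (Fin n)),
    Bornology.IsBounded A → A.Nontrivial → PartitionsIntoSmaller A m := by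
  have hc : IsCompact (Metric.closedBall (0 : EuclideanSpace ℝ (Fin n)) 1) :=
    isCompact_closedBall _ _
  -- Scaled by the diameter of `A`, balls of radius `1/4` give parts of at most half that diameter;
  -- `disjointed` then makes the cover a partition.
  obtain ⟨t, -, htf, ht⟩ := hc.finite_cover_balls (e := 1 / 4) (by norm_num)
  let c := htf.toFinset.equivFin.symm
  refine ⟨htf.toFinset.card, fun A hA hA2 => ?_⟩
  obtain ⟨a, ha, a', ha', haa'⟩ := hA2
  have hd : 0 < Metric.diam A := (dist_pos.2 haa').trans_le (Metric.dist_le_diam_of_mem hA ha ha')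
  let Q : Fin htf.toFinset.card → Set (EuclideanSpace ℝ (Fin n)) := fun i =>
    A ∩ Metric.closedBall (a + Metric.diam A • (c i).1) (Metric.diam A / 4)
  refine ⟨disjointed Q, ?_, disjoint_disjointed Q, fun i => ?_⟩
  · have : ⋃ i, disjointed Q i = ⋃ i, Q i := iSup_disjointed Q
    rw [this, ← Set.inter_iUnion, Set.inter_eq_left]
    intro x hx
    have hx1 : (Metric.diam A)⁻¹ • (x - a) ∈ Metric.closedBall (0 : EuclideanSpace ℝ (Fin n)) 1 := by
      rw [mem_closedBall_zero_iff, norm_smul, norm_inv, Real.norm_of_nonneg hd.le, inv_mul_le_one₀ hd,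
        ← dist_eq_norm]
      exact Metric.dist_le_diam_of_mem hA hx ha
    obtain ⟨p, hp, hxp⟩ := Set.mem_iUnion₂.1 (ht hx1)
    refine Set.mem_iUnion.2 ⟨c.symm ⟨p, htf.mem_toFinset.2 hp⟩, ?_⟩
    rw [Equiv.apply_symm_apply, mem_closedBall_iff_norm]
    rw [mem_ball_iff_norm] at hxp
    have : x - (a + Metric.diam A • p) =
        Metric.diam A • ((Metric.diam A)⁻¹ • (x - a) - p) := by
      rw [smul_sub, smul_inv_smul₀ hd.ne']
      abel
    rw [this, norm_smul, Real.norm_of_nonneg hd.le]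
    nlinarith
  · have hsub : disjointed Q i ⊆
        Metric.closedBall (a + Metric.diam A • (c i).1) (Metric.diam A / 4) :=
      (disjointed_le Q i).trans Set.inter_subset_right
    have h1 := Metric.diam_mono hsub Metric.isBounded_closedBall
    have h2 := Metric.diam_closedBall (x := a + Metric.diam A • (c i).1)
      (show 0 ≤ Metric.diam A / 4 by positivity)
    linarith

/-- A lower bound for the Borsuk number by means of a set in an affine subspace. -/
theorem le_borsukNumber_of_affineSubspace {N n m : ℕ} {B : Set (EuclideanSpace ℝ (Fin N))}
    (hB : Bornology.IsBounded B) (hB2 : B.Nontrivial)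
    {S : AffineSubspace ℝ (EuclideanSpace ℝ (Fin N))} (hS : Module.finrank ℝ S.direction = n)
    (hBS : B ⊆ S)
    (h : ∀ T ⊆ B, Metric.diam T < Metric.diam B → T.encard ≤ m) :
    B.ncard ≤ m * borsukNumber n := by
  -- Existence matters: the infimum of an empty set of naturals would be the default 0.
  have hmem : borsukNumber n ∈ _ := Nat.sInf_mem (exists_partitionsIntoSmaller n)
  obtain ⟨p, hp⟩ := hB2.nonempty
  let e : S.direction ≃ₗᵢ[ℝ] EuclideanSpace ℝ (Fin n) :=
    ((stdOrthonormalBasis ℝ S.direction).reindex (finCongr hS)).repr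
  -- `g` maps `ℝⁿ` isometrically onto `S`, so a partition of the preimage of `B` carries over to a
  -- cover of `B` by sets of smaller diameter.
  let g : EuclideanSpace ℝ (Fin n) → EuclideanSpace ℝ (Fin N) := fun y => (e.symm y : _) + p
  have hg : Isometry g := by
    refine Isometry.of_dist_eq fun y y' => ?_
    simp only [g, dist_add_right]
    exact e.symm.isometry.dist_eq y y'
  have hgB : g '' (g ⁻¹' B) = B := by
    rw [Set.image_preimage_eq_iff]
    intro x hx
    refine ⟨e ⟨x -ᵥ p, AffineSubspace.vsub_mem_direction (hBS hx) (hBS hp)⟩, ?_⟩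
    simp [g]
  have hb : Bornology.IsBounded (g ⁻¹' B) := hg.antilipschitz.isBounded_preimage hB
  have hnt : (g ⁻¹' B).Nontrivial := by
    rw [← hgB] at hB2
    exact Set.nontrivial_of_image g _ hB2
  obtain ⟨P, hPU, -, hPd⟩ := hmem (g ⁻¹' B) hb hnt
  have hcover : B = ⋃ i, g '' P i := by rw [← Set.image_iUnion, hPU, hgB]
  have hcard : ∀ i, (g '' P i).encard ≤ m := by
    intro i
    refine h _ ?_ ?_
    · rw [hcover]
      exact Set.subset_iUnion (fun i => g '' P i) i
    · rw [hg.diam_image, ← hgB, hg.diam_image]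
      exact hPd i
  have hfin : ∀ i, (g '' P i).Finite := fun i =>
    Set.finite_of_encard_le_coe (hcard i)
  have hn : ∀ i, (g '' P i).ncard ≤ m := by
    intro i
    have := hcard i
    rw [← (hfin i).cast_ncard_eq] at this
    exact_mod_cast this
  rw [hcover]
  refine (Set.ncard_iUnion_le_of_fintype _).trans ((Finset.sum_le_sum fun i _ => hn i).trans ?_)
  simp [mul_comm]

end Borsuk

theorem mainTheorem2 :
    ∃ (K : Set (EuclideanSpace ℝ (Fin 24))) (k l : Fin 24),
      K ⊆ Borsuk.M ∧ K.ncard = 143136 ∧ k < l ∧ (∀ x ∈ K, |x k| = |x l|) ∧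
      (∀ b : OrthonormalBasis Borsuk.BasisIndex ℝ (EuclideanSpace ℝ (Fin 324)),
        (∃ S : AffineSubspace ℝ (EuclideanSpace ℝ (Fin 324)),
          Module.finrank ℝ S.direction = 322 ∧ Borsuk.Phi b '' K ⊆ S) ∧
        (∀ T : Set (EuclideanSpace ℝ (Fin 324)), T ⊆ Borsuk.Phi b '' Borsuk.M →
          Metric.diam T < Metric.diam (Borsuk.Phi b '' Borsuk.M) → T.encard ≤ 350)) ∧
      ⌈(K.ncard : ℝ) / 350⌉₊ ≤ Borsuk.borsukNumber 322 ∧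
      ⌈(K.ncard : ℝ) / 350⌉₊ = 409 := by
  have hcard := Borsuk.ncard_balancedPoints
  have hM := Borsuk.balancedPoints_subset_M
  have habs : ∀ x ∈ Borsuk.balancedPoints, |x 0| = |x 1| :=
    fun _ hx => Borsuk.abs_eq_of_mem_balancedPoints hx
  have hnt : Borsuk.balancedPoints.Nontrivial := by
    refine (Set.one_lt_ncard_iff_nontrivial_and_finite.1 ?_).1
    rw [hcard]
    norm_num
  have h409 : ⌈((143136 : ℕ) : ℝ) / 350⌉₊ = 409 := by
    rw [Nat.ceil_eq_iff (by norm_num)]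
    norm_num
  have hS := fun b => Borsuk.exists_affineSubspace b zero_ne_one hM habs hnt.nonempty
  refine ⟨Borsuk.balancedPoints, 0, 1, hM, hcard, by decide, habs,
    fun b => ⟨hS b, fun T hT hd => Borsuk.encard_le_of_diam_lt b hT hd⟩, ?_, by rw [hcard, h409]⟩
  obtain ⟨b⟩ := Borsuk.nonempty_orthonormalBasis
  obtain ⟨S, hS322, hKS⟩ := hS b
  have hsub := Set.image_mono (f := Borsuk.Phi b) hM
  -- As `Φ(K) ⊆ Φ(M)`, a diameter below that of `Φ(K)` is also below that of `Φ(M)`, so the bound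
  -- 350 applies.
  have hle := Borsuk.le_borsukNumber_of_affineSubspace (m := 350)
    ((Borsuk.isBounded_Phi_M b).subset hsub) (hnt.image (Borsuk.Phi_injective b)) hS322 hKS
    fun T hT hd => Borsuk.encard_le_of_diam_lt b (hT.trans hsub)
      (hd.trans_le (Metric.diam_mono hsub (Borsuk.isBounded_Phi_M b)))
  rw [Set.ncard_image_of_injective _ (Borsuk.Phi_injective b), hcard] at hle
  rw [hcard, h409]
  -- `350 · 408 = 142800 < 143136`.
  omega
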